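/- Let $0<\alpha\le 2$ and let $B=\{B_t : t\in\mathbb{R}\}$ be a standard fractional Brownian motion with Hurst index $\alpha/2$, i.e., a centered Gaussian process with $$\operatorname{Cov}(B_s,B_t)=\tfrac12\left[|s|^\alpha+|t|^\alpha-|t-s|^\alpha\right],\qquad s,t\in\mathbb{R},$$ assumed to be separable (in the sense of Doob: there are a countable set $D\subset\mathbb{R}$ and a null event outside of which, for every open $U\subset\mathbb{R}$ and closed $F\subset\mathbb{R}$, $B_s\in F$ for all $s\in U\cap D$ implies $B_t\in F$ for all $t\in U$). Set $Z_t=\sqrt2\,B_t-|t|^\alpha$. Then for every $T>0$, $$\frac1T\,\mathbb{E}\left[\sup_{0\le t\le T}e^{Z_t}\right]=\int_0^1\mathbb{E}\left[\frac{\sup_{-uT\le s\le(1-u)T}e^{Z_s}}{\int_{-uT}^{(1-u)T}e^{Z_s}\,ds}\right]du .$$ Here all quantities are well defined and finite: almost surely, $t\mapsto e^{Z_t}$ is bounded and Lebesgue integrable on every compact interval; the random variable on the left and, for every $u\in[0,1]$, the ratio on the right are integrable; and the expectation on the right is an integrable function of $u\in[0,1]$. -/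

import Mathlib

open MeasureTheory ProbabilityTheory

/-- `B` is a standard two-sided fractional Brownian motion with Hurst index `α / 2`: a centered
Gaussian process indexed by `ℝ` with the covariance function
`(|s| ^ α + |t| ^ α - |t - s| ^ α) / 2`. -/
structure IsFractionalBrownianMotion {Ω : Type*} [MeasurableSpace Ω] (α : ℝ) (B : ℝ → Ω → ℝ)
    (P : Measure Ω) : Prop where
  isGaussianProcess : IsGaussianProcess B P
  centered : ∀ t, ∫ ω, B t ω ∂P = 0
  covariance_eq : ∀ s t,
    covariance (B s) (B t) P = 1 / 2 * (|s| ^ α + |t| ^ α - |t - s| ^ α)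

/-- Separability of a real process in the sense of Doob: there is a countable set `D` of times such
that, outside a null event, whenever all values of the path at the times of `D` in an open set `U`
lie in a closed set `F`, all values of the path on `U` lie in `F`. Continuity of the paths
is not required. -/
def IsSeparableProcess {Ω : Type*} [MeasurableSpace Ω] (X : ℝ → Ω → ℝ) (P : Measure Ω) : Prop :=
  ∃ D : Set ℝ, D.Countable ∧ ∀ᵐ ω ∂P, ∀ U F : Set ℝ, IsOpen U → IsClosed F →
    (∀ s ∈ U ∩ D, X s ω ∈ F) → ∀ t ∈ U, X t ω ∈ F

/-- The process `Z_t = √2 B_t - |t| ^ α`. -/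
noncomputable def driftedProcess {Ω : Type*} (α : ℝ) (B : ℝ → Ω → ℝ) (t : ℝ) (ω : Ω) : ℝ :=
  √2 * B t ω - |t| ^ α

/-- The supremum over `t ∈ [a, b]` of `exp (Z t ω)`. -/
noncomputable def expSup {Ω : Type*} (Z : ℝ → Ω → ℝ) (a b : ℝ) (ω : Ω) : ℝ :=
  sSup ((fun t ↦ Real.exp (Z t ω)) '' Set.Icc a b)

/-- The integral over `t ∈ [a, b]` of `exp (Z t ω)`. -/
noncomputable def expIntegral {Ω : Type*} (Z : ℝ → Ω → ℝ) (a b : ℝ) (ω : Ω) : ℝ :=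
  ∫ t in Set.Icc a b, Real.exp (Z t ω)

/-!
Write `R(z)` for the ratio of `sup exp z` and `∫ exp z` over `[0, T]`; it does not change when a
constant is added to `z`. The identity rests on the change of measure formula
`E[exp (Z t) * R(Z)] = E[R(Z (· - t))]` for `t ∈ [0, T]`. Integrating it over `t ∈ [0, T]`, the left
side becomes `E[(∫ exp Z) * R(Z)] = E[sup exp Z]`, and the substitution `t = u T` turns the right
side into `T` times the integral over `u` in the statement.

*Change of measure.* The density `exp (Z t)` has mean one, and under the measure it defines the
increments `Z s - Z t` have the finite-dimensional laws of `Z (s - t)`. A law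
on `ℝⁿ` with finite Laplace transform is determined by it, and the equality of the two Laplace
transforms is an identity between sums of covariances
(`IsFractionalBrownianMotion.map_tilted_driftedProcess`). The formula is applied to the ratio
`gridRatio` discretized along a grid, and passes to the limit `pathRatio` by dominated convergence
(`IsFractionalBrownianMotion.integral_exp_mul_pathRatio`).

*Regularity and domination.* All limits require continuous paths and a bound `M` for `|Z|` on
`[-T, T]` with `E[exp (3 M)] < ∞`. Both come from one dyadic chaining argument: the increments over
dyadic intervals of level `n` in `[-N, N]`, multiplied by `2 ^ (n α / 4)`, are bounded by a single
random variable with exponential moments of all orders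
(`IsFractionalBrownianMotion.exists_integrable_forall_dyadic`), because a high moment of an
increment weighted by an exponential is still summable over all dyadic intervals. The resulting
modulus of continuity on the separating set extends to all times by separability
(`continuousOn_and_abs_le_of_separable`).

*Integration over the shift.* Instead of interchanging the integrals over `t` and over `Ω`, which
would require joint measurability, `IsFractionalBrownianMotion.integral_integral_pathRatio` compares
Riemann sums in `t` of both sides.
-/

/-! ### Laplace transforms and the change of measure in finite dimension -/

section FiniteDimensional

open Finset in
/-- Two probability measures on `ι → ℝ` with the same everywhere finite Laplace transform are equal:
along every linear functional the moment generating functions agree, hence by analytic continuation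
so do the characteristic functions. -/
theorem measure_pi_ext_of_laplace {ι : Type*} [Fintype ι] {μ ν : Measure (ι → ℝ)}
    [IsProbabilityMeasure μ] [IsProbabilityMeasure ν]
    (hint : ∀ a : ι → ℝ, Integrable (fun x ↦ Real.exp (∑ i, a i * x i)) μ)
    (h : ∀ a : ι → ℝ, ∫ x, Real.exp (∑ i, a i * x i) ∂μ = ∫ x, Real.exp (∑ i, a i * x i) ∂ν) :
    μ = ν := by
  classical
  refine Measure.ext_of_charFunDual (funext fun L ↦ ?_)
  have hL : ∀ x : ι → ℝ, L x = ∑ i, L (Pi.single i 1) * x i := by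
    intro x
    rw [← L.coe_coe, L.toLinearMap.pi_apply_eq_sum_univ x]
    refine sum_congr rfl fun i _ ↦ ?_
    rw [smul_eq_mul, mul_comm]
    congr 2
    ext j
    simp [Pi.single_apply, eq_comm]
  have hexp : ∀ t : ℝ, (fun x ↦ Real.exp (t * L x)) =
      fun x ↦ Real.exp (∑ i, (t * L (Pi.single i 1)) * x i) := by
    intro t
    funext x
    rw [hL x, mul_sum]
    exact congrArg _ (sum_congr rfl fun i _ ↦ by ring)
  have hmgf : mgf L μ = mgf L ν := by
    funext t
    rw [mgf, mgf, hexp t]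
    exact h _
  have huniv : integrableExpSet L μ = Set.univ := by
    ext t
    refine iff_of_true ?_ trivial
    change Integrable (fun x ↦ Real.exp (t * L x)) μ
    rw [hexp t]
    exact hint _
  have := eqOn_complexMGF_of_mgf hmgf (x := Complex.I) (by simp [huniv])
  simpa [complexMGF, charFunDual_apply, mul_comm] using this

open Finset in
/-- The algebraic identity between the covariances of a process with variogram-type covariance
before and after the change of measure. -/
theorem variogram_sum_identity {ι : Type*} [Fintype ι] (a s d : ι → ℝ) (e : ι → ι → ℝ) (p : ℝ) :
    (1 - ∑ i, a i) * (1 - ∑ i, a i) * (1 / 2 * (p + p - 0)) +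
        ∑ j, (1 - ∑ i, a i) * a j * (1 / 2 * (p + s j - d j)) +
        ∑ i, (a i * (1 - ∑ i, a i) * (1 / 2 * (s i + p - d i)) +
          ∑ j, a i * a j * (1 / 2 * (s i + s j - e i j))) -
        ((1 - ∑ i, a i) * p + ∑ i, a i * s i) =
      ∑ i, ∑ j, a i * a j * (1 / 2 * (d i + d j - e i j)) - ∑ i, a i * d i := by
  have hdouble : ∀ f : ι → ℝ, ∑ i, ∑ j, a i * a j * (1 / 2 * (f i + f j - e i j)) =
      (∑ i, a i) * (∑ i, a i * f i) - 1 / 2 * ∑ i, ∑ j, a i * a j * e i j := by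
    intro f
    have h1 : ∑ i, ∑ j, a i * a j * f i = (∑ i, a i) * (∑ i, a i * f i) := by
      rw [mul_comm, sum_mul_sum]
      exact sum_congr rfl fun i _ ↦ sum_congr rfl fun j _ ↦ by ring
    have h2 : ∑ i, ∑ j, a i * a j * f j = (∑ i, a i) * (∑ i, a i * f i) := by
      rw [sum_mul_sum]
      exact sum_congr rfl fun i _ ↦ sum_congr rfl fun j _ ↦ by ring
    have h3 : ∀ i j, a i * a j * (1 / 2 * (f i + f j - e i j)) =
        1 / 2 * (a i * a j * f i) + 1 / 2 * (a i * a j * f j) - 1 / 2 * (a i * a j * e i j) :=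
      fun i j ↦ by ring
    simp_rw [h3, sum_sub_distrib, sum_add_distrib, ← mul_sum, h1, h2]
    ring
  have h4 : ∀ j, (1 - ∑ i, a i) * a j * (1 / 2 * (p + s j - d j)) = (1 - ∑ i, a i) * (1 / 2) *
      (a j * p + a j * s j - a j * d j) := fun j ↦ by ring
  have h5 : ∀ j, a j * (1 - ∑ i, a i) * (1 / 2 * (s j + p - d j)) = (1 - ∑ i, a i) * (1 / 2) *
      (a j * p + a j * s j - a j * d j) := fun j ↦ by ring
  rw [sum_add_distrib, hdouble, hdouble]
  simp_rw [h4, h5, ← mul_sum, sum_sub_distrib, sum_add_distrib, ← sum_mul]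
  ring

variable {Ω : Type*} [MeasurableSpace Ω] {P : Measure Ω} {α : ℝ} {B : ℝ → Ω → ℝ}

namespace IsFractionalBrownianMotion

theorem isProbabilityMeasure (hB : IsFractionalBrownianMotion α B P) : IsProbabilityMeasure P :=
  hB.isGaussianProcess.isProbabilityMeasure

theorem memLp_two (hB : IsFractionalBrownianMotion α B P) (t : ℝ) : MemLp (B t) 2 P :=
  (hB.isGaussianProcess.hasGaussianLaw_eval t).memLp_two

theorem variance_sum (hB : IsFractionalBrownianMotion α B P) {ι : Type*} [Fintype ι]
    (t c : ι → ℝ) :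
    Var[fun ω ↦ ∑ i, c i * B (t i) ω; P] =
      ∑ i, ∑ j, c i * c j * (1 / 2 * (|t i| ^ α + |t j| ^ α - |t j - t i| ^ α)) := by
  have := hB.isProbabilityMeasure
  have hmem := fun i ↦ (hB.memLp_two (t i)).const_mul (c i)
  rw [← covariance_self (Finset.aemeasurable_fun_sum _ fun i _ ↦ (hmem i).aemeasurable),
    covariance_fun_sum_fun_sum hmem hmem]
  refine Finset.sum_congr rfl fun i _ ↦ Finset.sum_congr rfl fun j _ ↦ ?_
  rw [covariance_const_mul_left, covariance_const_mul_right, hB.covariance_eq]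
  ring

/-- Finite linear combinations of the process are centered Gaussian. -/
theorem map_sum_eq_gaussianReal (hB : IsFractionalBrownianMotion α B P) {ι : Type*} [Fintype ι]
    (t c : ι → ℝ) :
    P.map (fun ω ↦ ∑ i, c i * B (t i) ω) = gaussianReal 0
      (∑ i, ∑ j, c i * c j * (1 / 2 * (|t i| ^ α + |t j| ^ α - |t j - t i| ^ α))).toNNReal := by
  have := hB.isProbabilityMeasure
  have hg : HasGaussianLaw (fun ω ↦ ∑ i, c i * B (t i) ω) P := by
    have h := (hB.isGaussianProcess.comp_right t).smul c
    simpa using h.hasGaussianLaw_fun_sum (I := Finset.univ)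
  rw [hg.map_eq_gaussianReal, hB.variance_sum t c,
    integral_finsetSum _ fun i _ ↦ ((hB.memLp_two (t i)).integrable one_le_two).const_mul (c i)]
  simp [integral_const_mul, hB.centered]

theorem aemeasurable (hB : IsFractionalBrownianMotion α B P) (t : ℝ) : AEMeasurable (B t) P :=
  hB.isGaussianProcess.aemeasurable t

theorem aemeasurable_driftedProcess (hB : IsFractionalBrownianMotion α B P) (t : ℝ) :
    AEMeasurable (driftedProcess α B t) P := by
  have := hB.aemeasurable t
  unfold driftedProcess
  fun_prop

omit [MeasurableSpace Ω] in
theorem sum_mul_driftedProcess {ι : Type*} [Fintype ι] (t c : ι → ℝ) (ω : Ω) :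
    ∑ i, c i * driftedProcess α B (t i) ω =
      1 * ∑ i, (√2 * c i) * B (t i) ω + -∑ i, c i * |t i| ^ α := by
  simp only [driftedProcess]
  rw [one_mul, ← sub_eq_add_neg, ← Finset.sum_sub_distrib]
  exact Finset.sum_congr rfl fun i _ ↦ by ring

theorem integrable_exp_sum (hB : IsFractionalBrownianMotion α B P) {ι : Type*} [Fintype ι]
    (t c : ι → ℝ) : Integrable (fun ω ↦ Real.exp (∑ i, c i * driftedProcess α B (t i) ω)) P := by
  simp only [sum_mul_driftedProcess, Real.exp_add]
  refine Integrable.mul_const ?_ _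
  have h := integrable_exp_mul_gaussianReal (μ := 0) (v := (∑ i, ∑ j, (√2 * c i) * (√2 * c j) *
    (1 / 2 * (|t i| ^ α + |t j| ^ α - |t j - t i| ^ α))).toNNReal) 1
  rw [← hB.map_sum_eq_gaussianReal t (fun i ↦ √2 * c i)] at h
  have hm : AEMeasurable (fun ω ↦ ∑ i, √2 * c i * B (t i) ω) P := by
    have := hB.aemeasurable
    fun_prop
  exact h.comp_aemeasurable hm

/-- The joint Laplace transform of the values of the drifted process. -/
theorem integral_exp_sum (hB : IsFractionalBrownianMotion α B P) {ι : Type*} [Fintype ι]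
    (t c : ι → ℝ) :
    ∫ ω, Real.exp (∑ i, c i * driftedProcess α B (t i) ω) ∂P =
      Real.exp (∑ i, ∑ j, c i * c j * (1 / 2 * (|t i| ^ α + |t j| ^ α - |t j - t i| ^ α)) -
        ∑ i, c i * |t i| ^ α) := by
  simp only [sum_mul_driftedProcess, Real.exp_add]
  rw [integral_mul_const]
  have h := mgf_gaussianReal (hB.map_sum_eq_gaussianReal t (fun i ↦ √2 * c i)) 1
  rw [mgf] at h
  rw [h, ← Real.exp_add, Real.coe_toNNReal _
    (hB.variance_sum t (fun i ↦ √2 * c i) ▸ variance_nonneg _ P)]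
  congr 1
  rw [sub_eq_add_neg]
  congr 1
  simp only [zero_add, one_pow, mul_one, Finset.sum_div]
  refine Finset.sum_congr rfl fun i _ ↦ Finset.sum_congr rfl fun j _ ↦ ?_
  have := Real.mul_self_sqrt (show (0 : ℝ) ≤ 2 by norm_num)
  linear_combination (c i * c j * (1 / 2 * (|t i| ^ α + |t j| ^ α - |t j - t i| ^ α)) / 2) * this

theorem integrable_exp_mul_driftedProcess (hB : IsFractionalBrownianMotion α B P) (t c : ℝ) :
    Integrable (fun ω ↦ Real.exp (c * driftedProcess α B t ω)) P := by
  simpa using hB.integrable_exp_sum (ι := Unit) (fun _ ↦ t) (fun _ ↦ c)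

theorem integrable_exp_driftedProcess (hB : IsFractionalBrownianMotion α B P) (t : ℝ) :
    Integrable (fun ω ↦ Real.exp (driftedProcess α B t ω)) P := by
  simpa using hB.integrable_exp_mul_driftedProcess t 1

theorem integral_exp_driftedProcess (hα : 0 < α) (hB : IsFractionalBrownianMotion α B P) (t : ℝ) :
    ∫ ω, Real.exp (driftedProcess α B t ω) ∂P = 1 := by
  have := hB.integral_exp_sum (ι := Unit) (fun _ ↦ t) (fun _ ↦ 1)
  simp only [Finset.univ_unique, Finset.sum_singleton, one_mul, sub_self, abs_zero,
    Real.zero_rpow hα.ne'] at this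
  rw [this, Real.exp_eq_one_iff]
  ring

/-- Under the probability measure with density `exp (Z t)`, the increments `Z s - Z t` have the
same finite-dimensional distributions as `Z (s - t)` under the original measure. -/
theorem map_tilted_driftedProcess (hα : 0 < α) (hB : IsFractionalBrownianMotion α B P) {ι : Type*}
    [Fintype ι] (t : ℝ) (s : ι → ℝ) :
    (P.tilted (driftedProcess α B t)).map
        (fun ω i ↦ driftedProcess α B (s i) ω - driftedProcess α B t ω) =
      P.map (fun ω i ↦ driftedProcess α B (s i - t) ω) := by
  have := hB.isProbabilityMeasure
  have hZ := hB.aemeasurable_driftedProcess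
  have hQ : IsProbabilityMeasure (P.tilted (driftedProcess α B t)) :=
    isProbabilityMeasure_tilted (hB.integrable_exp_driftedProcess t)
  have hZQ : ∀ r, AEMeasurable (driftedProcess α B r) (P.tilted (driftedProcess α B t)) :=
    fun r ↦ (hZ r).mono_ac (tilted_absolutelyContinuous _ _)
  have hm1 : AEMeasurable (fun ω i ↦ driftedProcess α B (s i) ω - driftedProcess α B t ω)
      (P.tilted (driftedProcess α B t)) :=
    aemeasurable_pi_lambda _ fun i ↦ (hZQ _).sub (hZQ _)
  have hm2 : AEMeasurable (fun ω i ↦ driftedProcess α B (s i - t) ω) P :=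
    aemeasurable_pi_lambda _ fun i ↦ hZ _
  have := Measure.isProbabilityMeasure_map hm1
  have := Measure.isProbabilityMeasure_map hm2
  -- The weighted exponential is again the exponential of a linear combination of values of `Z`; the
  -- index `none` stands for the time `t`.
  have key : ∀ (a : ι → ℝ) (ω : Ω), Real.exp (driftedProcess α B t ω) *
      Real.exp (∑ i, a i * (driftedProcess α B (s i) ω - driftedProcess α B t ω)) =
      Real.exp (∑ i : Option ι, (i.elim (1 - ∑ i, a i) a) *
        driftedProcess α B (i.elim t s) ω) := by
    intro a ω
    rw [← Real.exp_add, Fintype.sum_option]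
    congr 1
    simp only [Option.elim, mul_sub, Finset.sum_sub_distrib, ← Finset.sum_mul]
    ring
  have hmeas : ∀ a : ι → ℝ, Measurable (fun x : ι → ℝ ↦ Real.exp (∑ i, a i * x i)) := by
    intro a; fun_prop
  refine measure_pi_ext_of_laplace (fun a ↦ ?_) (fun a ↦ ?_)
  · rw [integrable_map_measure (hmeas a).aestronglyMeasurable hm1, integrable_tilted_iff
      (hB.integrable_exp_driftedProcess t)]
    simp only [Function.comp_def, smul_eq_mul, key]
    exact hB.integrable_exp_sum _ _
  · rw [integral_map hm1 (hmeas a).aestronglyMeasurable,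
      integral_map hm2 (hmeas a).aestronglyMeasurable, integral_tilted,
      integral_exp_driftedProcess hα hB]
    simp only [smul_eq_mul, div_one, key]
    rw [hB.integral_exp_sum, hB.integral_exp_sum]
    congr 1
    simp only [Fintype.sum_option, Option.elim, sub_self, abs_zero, Real.zero_rpow hα.ne',
      sub_sub_sub_cancel_right, abs_sub_comm _ t]
    exact variogram_sum_identity a (fun i ↦ |s i| ^ α) (fun i ↦ |t - s i| ^ α)
      (fun i j ↦ |s j - s i| ^ α) (|t| ^ α)

/-- The change of measure formula for functions of finitely many increments. -/
theorem integral_exp_mul_comp (hα : 0 < α) (hB : IsFractionalBrownianMotion α B P) {ι : Type*}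
    [Fintype ι] (t : ℝ) (s : ι → ℝ) {φ : (ι → ℝ) → ℝ} (hφ : Measurable φ)
    (hinv : ∀ x c, φ (fun i ↦ x i - c) = φ x) :
    ∫ ω, Real.exp (driftedProcess α B t ω) * φ (fun i ↦ driftedProcess α B (s i) ω) ∂P =
      ∫ ω, φ (fun i ↦ driftedProcess α B (s i - t) ω) ∂P := by
  have hZ := hB.aemeasurable_driftedProcess
  have hZQ : ∀ r, AEMeasurable (driftedProcess α B r) (P.tilted (driftedProcess α B t)) :=
    fun r ↦ (hZ r).mono_ac (tilted_absolutelyContinuous _ _)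
  have hm : AEMeasurable (fun ω i ↦ driftedProcess α B (s i) ω - driftedProcess α B t ω)
      (P.tilted (driftedProcess α B t)) :=
    aemeasurable_pi_lambda _ fun i ↦ (hZQ _).sub (hZQ _)
  rw [← integral_map (aemeasurable_pi_lambda _ fun i ↦ hZ _) hφ.aestronglyMeasurable,
    ← hB.map_tilted_driftedProcess hα t s,
    integral_map hm hφ.aestronglyMeasurable,
    integral_tilted, integral_exp_driftedProcess hα hB]
  simp only [hinv _ _, div_one, smul_eq_mul]

end IsFractionalBrownianMotion

end FiniteDimensional

/-! ### Dyadic chaining for a deterministic function -/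

section Dyadic

open Filter Topology

/-- The largest multiple of `2⁻ⁿ` that is at most `t`. -/
noncomputable def dyadicFloor (n : ℕ) (t : ℝ) : ℝ := ⌊2 ^ n * t⌋ / 2 ^ n

theorem dyadicFloor_le (n : ℕ) (t : ℝ) : dyadicFloor n t ≤ t := by
  rw [dyadicFloor, div_le_iff₀ (by positivity), mul_comm t]
  exact Int.floor_le _

theorem lt_dyadicFloor_add (n : ℕ) (t : ℝ) : t < dyadicFloor n t + 1 / 2 ^ n := by
  rw [dyadicFloor, ← add_div, lt_div_iff₀ (by positivity), mul_comm t]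
  exact Int.lt_floor_add_one _

/-- The increments of `f` over the dyadic intervals of level `n` that lie in `[-N, N]` are at most
`y * ρ ^ n`, for every `n`. -/
def DyadicIncrementBound (f : ℝ → ℝ) (N : ℕ) (y ρ : ℝ) : Prop :=
  ∀ (n : ℕ) (k : ℤ), -(N * 2 ^ n : ℤ) ≤ k → k < N * 2 ^ n →
    |f ((k + 1) / 2 ^ n) - f (k / 2 ^ n)| ≤ y * ρ ^ n

theorem floor_mem_range {N : ℕ} {t : ℝ} (h1 : -N < t) (h2 : t < N) (n : ℕ) :
    -(N * 2 ^ n : ℤ) ≤ ⌊2 ^ n * t⌋ ∧ ⌊2 ^ n * t⌋ < (N * 2 ^ n : ℤ) := by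
  have hp : (0 : ℝ) < 2 ^ n := by positivity
  constructor
  · rw [Int.le_floor]
    push_cast
    nlinarith
  · rw [Int.floor_lt]
    push_cast
    nlinarith

namespace DyadicIncrementBound

variable {f : ℝ → ℝ} {N : ℕ} {y ρ : ℝ}

theorem abs_sub_dyadicFloor_succ_le (h : DyadicIncrementBound f N y ρ) (hy : 0 ≤ y) (hρ : 0 ≤ ρ)
    {t : ℝ} (h1 : -N < t) (h2 : t < N) (n : ℕ) :
    |f (dyadicFloor n t) - f (dyadicFloor (n + 1) t)| ≤ y * ρ * ρ ^ n := by
  obtain ⟨hk1, hk2⟩ := floor_mem_range h1 h2 n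
  set k := ⌊2 ^ n * t⌋ with hk
  -- At level `n + 1` the two approximations are equal or the endpoints of the interval `2 k`.
  have hp : (0 : ℝ) < 2 ^ n := by positivity
  have hn : dyadicFloor n t = ((2 * k : ℤ) : ℝ) / 2 ^ (n + 1) := by
    rw [dyadicFloor, ← hk, pow_succ]
    push_cast
    field_simp
  have hk' : ⌊2 ^ (n + 1) * t⌋ = 2 * k ∨ ⌊2 ^ (n + 1) * t⌋ = 2 * k + 1 := by
    have ha : 2 * k ≤ ⌊2 ^ (n + 1) * t⌋ := by
      rw [Int.le_floor, pow_succ]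
      push_cast
      linarith [Int.floor_le (2 ^ n * t)]
    have hb : ⌊2 ^ (n + 1) * t⌋ < 2 * k + 2 := by
      rw [Int.floor_lt, pow_succ]
      push_cast
      linarith [Int.lt_floor_add_one (2 ^ n * t)]
    omega
  rw [hn]
  rcases hk' with hk' | hk'
  · rw [dyadicFloor, hk']
    simp only [sub_self, abs_zero]
    positivity
  · rw [dyadicFloor, hk', abs_sub_comm]
    have := h (n + 1) (2 * k) (by rw [pow_succ, ← mul_assoc]; omega)
      (by rw [pow_succ, ← mul_assoc]; omega)
    rw [pow_succ' ρ, ← mul_assoc] at this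
    push_cast at this ⊢
    exact this

theorem abs_sub_dyadicFloor_le (h : DyadicIncrementBound f N y ρ) (hy : 0 ≤ y) (hρ : 0 ≤ ρ)
    (hρ1 : ρ < 1) {t : ℝ} (h1 : -N < t) (h2 : t < N)
    (hlim : Tendsto (fun n ↦ f (dyadicFloor n t)) atTop (𝓝 (f t))) (n : ℕ) :
    |f (dyadicFloor n t) - f t| ≤ y / (1 - ρ) * ρ ^ n := by
  have := dist_le_of_le_geometric_of_tendsto ρ (y * ρ) hρ1
    (fun n ↦ h.abs_sub_dyadicFloor_succ_le hy hρ h1 h2 n) hlim n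
  refine this.trans ?_
  have h3 : 0 < 1 - ρ := by linarith
  rw [div_mul_eq_mul_div]
  have : y * ρ ≤ y := mul_le_of_le_one_right hy hρ1.le
  gcongr

/-- The level `n` approximations of two points at distance at most `2⁻ⁿ` are equal or adjacent. -/
theorem abs_sub_dyadicFloor_dyadicFloor_le (h : DyadicIncrementBound f N y ρ) (hy : 0 ≤ y)
    (hρ : 0 ≤ ρ) {s t : ℝ} (hs1 : -N < s) (hs2 : s < N) (ht1 : -N < t) (ht2 : t < N) {n : ℕ}
    (hst : |s - t| ≤ 1 / 2 ^ n) :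
    |f (dyadicFloor n s) - f (dyadicFloor n t)| ≤ y * ρ ^ n := by
  wlog hle : s ≤ t generalizing s t
  · rw [abs_sub_comm]
    exact this ht1 ht2 hs1 hs2 (by rwa [abs_sub_comm]) (le_of_not_ge hle)
  have hp : (0 : ℝ) < 2 ^ n := by positivity
  rw [le_div_iff₀ hp, abs_of_nonpos (by linarith)] at hst
  obtain ⟨hk1, hk2⟩ := floor_mem_range hs1 hs2 n
  have hl : ⌊2 ^ n * s⌋ ≤ ⌊2 ^ n * t⌋ := Int.floor_le_floor (by gcongr)
  have hu : ⌊2 ^ n * t⌋ < ⌊2 ^ n * s⌋ + 2 := by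
    rw [Int.floor_lt]
    push_cast
    linarith [Int.lt_floor_add_one (2 ^ n * s)]
  obtain he | he : ⌊2 ^ n * t⌋ = ⌊2 ^ n * s⌋ ∨ ⌊2 ^ n * t⌋ = ⌊2 ^ n * s⌋ + 1 := by omega
  · rw [dyadicFloor, dyadicFloor, he, sub_self, abs_zero]
    positivity
  · rw [dyadicFloor, dyadicFloor, he, abs_sub_comm]
    simpa using h n _ hk1 hk2

theorem abs_sub_le (h : DyadicIncrementBound f N y ρ) (hy : 0 ≤ y)
    (hρ : 0 ≤ ρ) (hρ1 : ρ < 1) {s t : ℝ} (hs1 : -N < s) (hs2 : s < N) (ht1 : -N < t) (ht2 : t < N)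
    (hs : Tendsto (fun n ↦ f (dyadicFloor n s)) atTop (𝓝 (f s)))
    (ht : Tendsto (fun n ↦ f (dyadicFloor n t)) atTop (𝓝 (f t))) {n : ℕ}
    (hst : |s - t| ≤ 1 / 2 ^ n) :
    |f s - f t| ≤ (y / (1 - ρ) + y + y / (1 - ρ)) * ρ ^ n := by
  have e1 := h.abs_sub_dyadicFloor_le hy hρ hρ1 hs1 hs2 hs n
  have e2 := h.abs_sub_dyadicFloor_le hy hρ hρ1 ht1 ht2 ht n
  have e3 := h.abs_sub_dyadicFloor_dyadicFloor_le hy hρ hs1 hs2 ht1 ht2 hst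
  rw [abs_sub_comm] at e1
  calc |f s - f t| ≤ |f s - f (dyadicFloor n s)| + |f (dyadicFloor n s) - f (dyadicFloor n t)|
        + |f (dyadicFloor n t) - f t| :=
      (_root_.abs_sub_le _ (f (dyadicFloor n t)) _).trans
        (by gcongr; exact _root_.abs_sub_le _ _ _)
    _ ≤ _ := by linarith

theorem abs_le (h : DyadicIncrementBound f N y ρ) (hy : 0 ≤ y)
    (hρ : 0 ≤ ρ) (hρ1 : ρ < 1) (h0 : f 0 = 0) {t : ℝ} (ht1 : -N < t) (ht2 : t < N)
    (ht : Tendsto (fun n ↦ f (dyadicFloor n t)) atTop (𝓝 (f t))) :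
    |f t| ≤ (1 / (1 - ρ) + N) * y := by
  -- The integer part of `t` is reached from `0` in at most `N` unit steps.
  have hunit : ∀ k : ℤ, -(N : ℤ) ≤ k → k < N → |f (k + 1) - f k| ≤ y := fun k h1 h2 ↦ by
    simpa using h 0 k (by simpa using h1) (by simpa using h2)
  have hpos : ∀ j : ℕ, j ≤ N → |f j| ≤ j * y ∧ |f (-j)| ≤ j * y := by
    intro j
    induction j with
    | zero => simp [h0]
    | succ j ih =>
      intro hj
      obtain ⟨i1, i2⟩ := ih (by omega)
      have e1 := hunit j (by omega) (by omega)
      have e2 := hunit (-(j + 1 : ℕ)) (by omega) (by omega)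
      push_cast at e1 e2 ⊢
      rw [show (-((j : ℝ) + 1) + 1) = -j by ring] at e2
      rw [abs_le'] at i1 i2 e1 e2
      refine ⟨abs_le'.2 ⟨?_, ?_⟩, abs_le'.2 ⟨?_, ?_⟩⟩ <;> linarith
  have hf0 : dyadicFloor 0 t = ⌊t⌋ := by simp [dyadicFloor]
  have hfl : |f ⌊t⌋| ≤ N * y := by
    obtain ⟨hk1, hk2⟩ := floor_mem_range ht1 ht2 0
    simp only [pow_zero, mul_one, one_mul] at hk1 hk2
    rcases le_total 0 ⌊t⌋ with hp | hp
    · lift ⌊t⌋ to ℕ using hp with j hj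
      have := (hpos j (by omega)).1
      refine (by simpa using this : |f ((j : ℤ) : ℝ)| ≤ j * y).trans ?_
      gcongr
      omega
    · obtain ⟨j, hj⟩ : ∃ j : ℕ, ⌊t⌋ = -j := ⟨(-⌊t⌋).toNat, by omega⟩
      have hjN : j ≤ N := by omega
      rw [hj]
      have := (hpos j hjN).2
      refine (by simpa using this : |f ((-j : ℤ) : ℝ)| ≤ j * y).trans ?_
      gcongr
  have e := h.abs_sub_dyadicFloor_le hy hρ hρ1 ht1 ht2 ht 0
  rw [hf0, pow_zero, mul_one, abs_sub_comm] at e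
  have e' : |f t| ≤ |f t - f ⌊t⌋| + |f ⌊t⌋| := by
    simpa using abs_add_le (f t - f ⌊t⌋) (f ⌊t⌋)
  rw [add_mul, one_div_mul_eq_div]
  linarith

end DyadicIncrementBound

/-- A function with small dyadic increments that is determined by its values on `D` (in the sense
of Doob separability) and is on `D` the limit of its dyadic approximations, is continuous and
satisfies the chaining bound. -/
theorem continuousOn_and_abs_le_of_separable {f : ℝ → ℝ} {D : Set ℝ} {N : ℕ} {y ρ : ℝ}
    (h : DyadicIncrementBound f N y ρ) (hy : 0 ≤ y) (hρ : 0 ≤ ρ) (hρ1 : ρ < 1) (h0 : f 0 = 0)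
    (hD : ∀ t ∈ D, Tendsto (fun n ↦ f (dyadicFloor n t)) atTop (𝓝 (f t)))
    (hsep : ∀ U F : Set ℝ, IsOpen U → IsClosed F → (∀ s ∈ U ∩ D, f s ∈ F) → ∀ t ∈ U, f t ∈ F) :
    ContinuousOn f (Set.Ioo (-N) N) ∧
      ∀ t ∈ Set.Ioo (-N : ℝ) N, |f t| ≤ (1 / (1 - ρ) + N) * y := by
  set K := y / (1 - ρ) + y + y / (1 - ρ) with hK
  -- taking `F = ∅` shows that `D` is dense
  have hdense : ∀ U : Set ℝ, IsOpen U → U.Nonempty → ∃ s, s ∈ U ∩ D := by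
    intro U hU ⟨t, ht⟩
    by_contra! hne
    exact hsep U ∅ hU isClosed_empty (fun s hs ↦ hne s hs) t ht
  -- Separability extends the modulus of continuity in one argument, density in the other.
  have hone : ∀ s ∈ Set.Ioo (-N : ℝ) N ∩ D, ∀ t ∈ Set.Ioo (-N : ℝ) N, ∀ n : ℕ,
      |t - s| < 1 / 2 ^ n → |f t - f s| ≤ K * ρ ^ n := by
    intro s hs t ht n hts
    refine hsep (Set.Ioo (-N : ℝ) N ∩ Metric.ball s (1 / 2 ^ n))
      (Metric.closedBall (f s) (K * ρ ^ n)) (isOpen_Ioo.inter Metric.isOpen_ball)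
      Metric.isClosed_closedBall (fun r hr ↦ ?_) t ⟨ht, hts⟩
    exact h.abs_sub_le hy hρ hρ1 hr.1.1.1 hr.1.1.2 hs.1.1 hs.1.2 (hD r hr.2) (hD s hs.2)
      (le_of_lt hr.1.2)
  have htwo : ∀ t ∈ Set.Ioo (-N : ℝ) N, ∀ t' ∈ Set.Ioo (-N : ℝ) N, ∀ n : ℕ,
      |t' - t| < 1 / 2 ^ n → |f t' - f t| ≤ 2 * K * ρ ^ n := by
    intro t ht t' ht' n htt
    obtain ⟨s, ⟨⟨hs1, hs2⟩, hs3⟩, hs⟩ := hdense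
      ((Set.Ioo (-N : ℝ) N ∩ Metric.ball t (1 / 2 ^ n)) ∩ Metric.ball t' (1 / 2 ^ n))
      ((isOpen_Ioo.inter Metric.isOpen_ball).inter Metric.isOpen_ball)
      ⟨t, ⟨ht, Metric.mem_ball_self (by positivity)⟩, by
        rw [Metric.mem_ball, dist_comm]; exact htt⟩
    rw [Metric.mem_ball, dist_comm, Real.dist_eq] at hs2 hs3
    have e1 := hone s ⟨hs1, hs⟩ t ht n hs2
    have e2 := hone s ⟨hs1, hs⟩ t' ht' n hs3
    rw [abs_sub_comm] at e1
    have := abs_sub_le (f t') (f s) (f t)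
    linarith
  refine ⟨fun t ht ↦ ?_, fun t ht ↦ ?_⟩
  · refine (Metric.continuousAt_iff.2 fun ε hε ↦ ?_).continuousWithinAt
    have hlim : Tendsto (fun n ↦ 2 * K * ρ ^ n) atTop (𝓝 0) := by
      simpa using (tendsto_pow_atTop_nhds_zero_of_lt_one hρ hρ1).const_mul (2 * K)
    obtain ⟨n, hn⟩ := (hlim.eventually_lt_const hε).exists
    obtain ⟨δ, hδ, hball⟩ := Metric.isOpen_iff.1
      (isOpen_Ioo.inter (Metric.isOpen_ball (x := t) (ε := 1 / 2 ^ n))) t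
      ⟨ht, Metric.mem_ball_self (by positivity)⟩
    exact ⟨δ, hδ, fun {t'} ht' ↦
      (htwo t ht t' (hball ht').1 n (hball ht').2).trans_lt hn⟩
  · have := hsep (Set.Ioo (-N : ℝ) N) (Metric.closedBall 0 ((1 / (1 - ρ) + N) * y)) isOpen_Ioo
      Metric.isClosed_closedBall (fun s hs ↦ by
        simpa using h.abs_le hy hρ hρ1 h0 hs.1.1 hs.1.2 (hD s hs.2)) t ht
    simpa using this

end Dyadic

/-! ### Regularity and exponential moments of the paths -/

section Paths

open Filter Topology
open scoped ENNReal NNReal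

theorem integrable_pow_abs_mul_exp_abs_gaussianReal (v : ℝ≥0) (m : ℕ) {c : ℝ} (hc : 0 ≤ c) :
    Integrable (fun x ↦ |x| ^ m * Real.exp (c * |x|)) (gaussianReal 0 v) := by
  have h := integrable_pow_abs_mul_exp_add_of_integrable_exp_mul (X := fun x ↦ x)
    (μ := gaussianReal 0 v) (v := 0) (t := c + 1) (x := c)
    (integrable_exp_mul_gaussianReal _) (integrable_exp_mul_gaussianReal _) hc
    (by rw [abs_of_nonneg (by linarith)]; linarith) m
  simpa using h

/-- The constant in the moment bound for the increments: the expectation of `|X|ᵐ exp (c |X|)` for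
a standard Gaussian variable `X`. -/
noncomputable def gaussianMomentConst (m : ℕ) (c : ℝ) : ℝ≥0∞ :=
  ∫⁻ x, ENNReal.ofReal (|x| ^ m * Real.exp (c * |x|)) ∂(gaussianReal 0 1)

theorem gaussianMomentConst_ne_top (m : ℕ) {c : ℝ} (hc : 0 ≤ c) : gaussianMomentConst m c ≠ ∞ :=
  (integrable_pow_abs_mul_exp_abs_gaussianReal 1 m hc).lintegral_lt_top.ne

namespace IsFractionalBrownianMotion

variable {Ω : Type*} [MeasurableSpace Ω] {P : Measure Ω} {α : ℝ} {B : ℝ → Ω → ℝ}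

theorem map_sub_eq_gaussianReal (hα : 0 < α) (hB : IsFractionalBrownianMotion α B P) (s t : ℝ)
    {σ : ℝ} (hσ : σ ^ 2 = |t - s| ^ α) :
    P.map (fun ω ↦ B t ω - B s ω) = (gaussianReal 0 1).map (σ * ·) := by
  have h := hB.map_sum_eq_gaussianReal (ι := Fin 2) ![t, s] ![1, -1]
  simp only [Fin.sum_univ_two, Matrix.cons_val_zero, Matrix.cons_val_one, sub_self, abs_zero,
    Real.zero_rpow hα.ne', one_mul, neg_one_mul, ← sub_eq_add_neg] at h
  rw [h, gaussianReal_map_const_mul, mul_zero, mul_one]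
  congr 1
  rw [← NNReal.coe_inj, NNReal.coe_mk, Real.coe_toNNReal', hσ, abs_sub_comm s t]
  ring_nf
  exact max_eq_left (by positivity)

/-- The moment bound behind the chaining argument: with `w` times the standard deviation of an
increment equal to `σ ≤ 1`, the factor `σ ^ m` survives the exponential weight. -/
theorem lintegral_increment_le (hα : 0 < α) (hB : IsFractionalBrownianMotion α B P) (s t : ℝ)
    {w σ c : ℝ} (m : ℕ) (hw : 0 ≤ w) (hσ : 0 ≤ σ) (hσ1 : w * σ ≤ 1) (hc : 0 ≤ c)
    (hσ2 : σ ^ 2 = |t - s| ^ α) :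
    ∫⁻ ω, ENNReal.ofReal ((w * |B t ω - B s ω|) ^ m * Real.exp (c * (w * |B t ω - B s ω|))) ∂P ≤
      ENNReal.ofReal ((w * σ) ^ m) * gaussianMomentConst m c := by
  have hm : AEMeasurable (fun ω ↦ B t ω - B s ω) P := (hB.aemeasurable t).sub (hB.aemeasurable s)
  have hmeas : Measurable fun x : ℝ ↦
      ENNReal.ofReal ((w * |x|) ^ m * Real.exp (c * (w * |x|))) := by fun_prop
  rw [← lintegral_map' (f := fun x ↦ ENNReal.ofReal ((w * |x|) ^ m * Real.exp (c * (w * |x|))))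
    hmeas.aemeasurable hm, hB.map_sub_eq_gaussianReal hα s t hσ2,
    lintegral_map hmeas (by fun_prop), gaussianMomentConst, ← lintegral_const_mul _ (by fun_prop)]
  refine lintegral_mono fun x ↦ ?_
  simp only
  rw [← ENNReal.ofReal_mul (by positivity), ← mul_assoc ((w * σ) ^ m), ← mul_pow, abs_mul,
    abs_of_nonneg hσ, ← mul_assoc w]
  gcongr
  exact mul_le_of_le_one_left (abs_nonneg x) hσ1

theorem ae_eval_zero (hα : 0 < α) (hB : IsFractionalBrownianMotion α B P) :
    ∀ᵐ ω ∂P, B 0 ω = 0 := by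
  have h := hB.map_sum_eq_gaussianReal (ι := Unit) (fun _ ↦ 0) (fun _ ↦ 1)
  simp only [Finset.univ_unique, Finset.sum_singleton, sub_self, abs_zero,
    Real.zero_rpow hα.ne', one_mul, add_zero, mul_zero, Real.toNNReal_zero,
    gaussianReal_zero_var] at h
  have : ∀ᵐ x ∂(P.map (B 0)), x = 0 := by
    rw [show B 0 = fun ω ↦ B 0 ω from rfl, h]
    simp [ae_dirac_eq]
  exact ae_of_ae_map (hB.aemeasurable 0) this

/-- Along the dyadic approximations of a fixed time the process converges almost surely. -/
theorem ae_tendsto_dyadicFloor (hα : 0 < α) (hB : IsFractionalBrownianMotion α B P) (t : ℝ) :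
    ∀ᵐ ω ∂P, Tendsto (fun n ↦ B (dyadicFloor n t) ω) atTop (𝓝 (B t ω)) := by
  set r : ℝ := (1 / 2) ^ (α / 2) with hr
  have hr0 : 0 ≤ r := by positivity
  have hr1 : r < 1 := Real.rpow_lt_one (by norm_num) (by norm_num) (by linarith)
  have hdist : ∀ n, |t - dyadicFloor n t| ≤ 1 / 2 ^ n := fun n ↦ by
    rw [abs_of_nonneg (by linarith [dyadicFloor_le n t])]
    linarith [lt_dyadicFloor_add n t]
  have hσ : ∀ n, |t - dyadicFloor n t| ^ (α / 2) ≤ r ^ n := fun n ↦ by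
    calc |t - dyadicFloor n t| ^ (α / 2) ≤ (1 / 2 ^ n) ^ (α / 2) :=
          Real.rpow_le_rpow (abs_nonneg _) (hdist n) (by linarith)
      _ = r ^ n := by
          rw [hr, ← one_div_pow, ← Real.rpow_natCast, ← Real.rpow_natCast, ← Real.rpow_mul
            (by norm_num), ← Real.rpow_mul (by norm_num), mul_comm]
  have hbound : ∀ n, ∫⁻ ω, ENNReal.ofReal |B t ω - B (dyadicFloor n t) ω| ∂P ≤
      ENNReal.ofReal r ^ n * gaussianMomentConst 1 0 := by
    intro n
    have h := hB.lintegral_increment_le hα (dyadicFloor n t) t (w := 1)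
      (σ := |t - dyadicFloor n t| ^ (α / 2)) (c := 0) 1 zero_le_one (by positivity)
      (by rw [one_mul]; exact (hσ n).trans (pow_le_one₀ hr0 hr1.le)) le_rfl
      (by rw [← Real.rpow_natCast, ← Real.rpow_mul (abs_nonneg _)]; congr 1; push_cast; ring)
    simp only [one_mul, pow_one, zero_mul, Real.exp_zero, mul_one] at h
    refine h.trans ?_
    rw [← ENNReal.ofReal_pow hr0]
    gcongr
    exact hσ n
  have hmeas : ∀ n, AEMeasurable
      (fun ω ↦ ENNReal.ofReal |B t ω - B (dyadicFloor n t) ω|) P := fun n ↦ by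
    have := hB.aemeasurable t
    have := hB.aemeasurable (dyadicFloor n t)
    fun_prop
  have hsum : ∫⁻ ω, ∑' n, ENNReal.ofReal |B t ω - B (dyadicFloor n t) ω| ∂P ≠ ∞ := by
    rw [lintegral_tsum hmeas]
    refine ne_top_of_le_ne_top ?_ (ENNReal.tsum_le_tsum hbound)
    rw [ENNReal.tsum_mul_right, ENNReal.tsum_geometric]
    refine ENNReal.mul_ne_top (ENNReal.inv_ne_top.2 ?_) (gaussianMomentConst_ne_top 1 le_rfl)
    exact (tsub_pos_of_lt (by simpa using hr1)).ne'
  filter_upwards [ae_lt_top' (AEMeasurable.tsum hmeas) hsum] with ω hω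
  have := ENNReal.tendsto_atTop_zero_of_tsum_ne_top hω.ne
  have h2 := (ENNReal.tendsto_toReal ENNReal.zero_ne_top).comp this
  simp only [Function.comp_def, ENNReal.toReal_ofReal (abs_nonneg _), ENNReal.toReal_zero] at h2
  rw [tendsto_iff_dist_tendsto_zero]
  simpa only [Real.dist_eq, abs_sub_comm] using h2

/-- The increments over the dyadic intervals of level `n` in `[-N, N]` are at most `Y * ρ ^ n` for
all `n`, with a random variable `Y` such that `exp (c Y)` is integrable. Here `Y = log G / c`. -/
theorem exists_integrable_forall_dyadic (hα : 0 < α) (hB : IsFractionalBrownianMotion α B P)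
    (N : ℕ) {c : ℝ} (hc : 0 < c) {ρ : ℝ} (hρ : ρ = 2 ^ (-(α / 4))) :
    ∃ G : Ω → ℝ, Integrable G P ∧ (∀ ω, 1 ≤ G ω) ∧
      ∀ᵐ ω ∂P, DyadicIncrementBound (fun t ↦ B t ω) N (Real.log (G ω) / c) ρ := by
  have := hB.isProbabilityMeasure
  have hρ0 : 0 < ρ := by rw [hρ]; positivity
  have hρ1 : ρ < 1 := by
    rw [hρ]; exact Real.rpow_lt_one_of_one_lt_of_neg (by norm_num) (by linarith)
  -- the moment order is chosen so large that the sum over the `2 N 2ⁿ` intervals converges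
  obtain ⟨m, hm⟩ := exists_pow_lt_of_lt_one (show (0 : ℝ) < 1 / 2 by norm_num) hρ1
  -- The standard deviation at level `n` is `ρ ^ (2 n)`, and `ρ ^ (-n)` times it is `ρ ^ n`.
  let x : ℕ → ℤ → Ω → ℝ := fun n k ω ↦
    (ρ⁻¹) ^ n * |B ((k + 1) / 2 ^ n) ω - B (k / 2 ^ n) ω|
  let I : ℕ → Finset ℤ := fun n ↦ Finset.Ico (-(N * 2 ^ n : ℤ)) (N * 2 ^ n)
  let S : Ω → ℝ≥0∞ := fun ω ↦
    ∑' n, ∑ k ∈ I n, ENNReal.ofReal ((x n k ω) ^ m * Real.exp (c * x n k ω))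
  have hx0 : ∀ n k ω, 0 ≤ x n k ω := fun n k ω ↦ by positivity
  have hterm : ∀ n k, ∫⁻ ω, ENNReal.ofReal ((x n k ω) ^ m * Real.exp (c * x n k ω)) ∂P ≤
      ENNReal.ofReal ((ρ ^ m) ^ n) * gaussianMomentConst m c := by
    intro n k
    have hlen : ((k : ℝ) + 1) / 2 ^ n - k / 2 ^ n = 1 / 2 ^ n := by ring
    have hσρ : ρ⁻¹ ^ n * (ρ ^ 2) ^ n = ρ ^ n := by
      rw [← mul_pow]; congr 1; field_simp
    have h := hB.lintegral_increment_le hα (k / 2 ^ n) ((k + 1) / 2 ^ n) (w := ρ⁻¹ ^ n)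
      (σ := (ρ ^ 2) ^ n) (c := c) m (by positivity) (by positivity)
      (by rw [hσρ]; exact pow_le_one₀ hρ0.le hρ1.le) hc.le (by
        rw [hlen, abs_of_nonneg (by positivity), hρ, one_div, ← Real.rpow_natCast 2 n,
          ← Real.rpow_neg (by norm_num), ← Real.rpow_mul (by norm_num)]
        simp only [← Real.rpow_natCast]
        simp only [← Real.rpow_mul (show (0 : ℝ) ≤ 2 by norm_num)]
        congr 1
        push_cast
        ring)
    rwa [hσρ, pow_right_comm] at h
  have hmeas : ∀ n, ∀ k ∈ I n, AEMeasurable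
      (fun ω ↦ ENNReal.ofReal ((x n k ω) ^ m * Real.exp (c * x n k ω))) P := fun n k _ ↦ by
    have h1 := hB.aemeasurable ((k + 1) / 2 ^ n)
    have h2 := hB.aemeasurable (k / 2 ^ n)
    have : AEMeasurable (x n k) P := by
      simp only [x]
      fun_prop
    fun_prop
  have hmeas' : ∀ n, AEMeasurable
      (fun ω ↦ ∑ k ∈ I n, ENNReal.ofReal ((x n k ω) ^ m * Real.exp (c * x n k ω))) P :=
    fun n ↦ Finset.aemeasurable_fun_sum _ (hmeas n)
  have hSm : AEMeasurable S P := AEMeasurable.tsum hmeas'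
  have hS : ∫⁻ ω, S ω ∂P ≠ ∞ := by
    simp only [S]
    rw [lintegral_tsum hmeas']
    have hle : ∀ n, ∫⁻ ω, ∑ k ∈ I n, ENNReal.ofReal ((x n k ω) ^ m * Real.exp (c * x n k ω)) ∂P ≤
        ENNReal.ofReal (2 * ρ ^ m) ^ n * (ENNReal.ofReal (2 * N) * gaussianMomentConst m c) := by
      intro n
      rw [lintegral_finsetSum' _ (hmeas n)]
      refine (Finset.sum_le_card_nsmul _ _ _ fun k _ ↦ hterm n k).trans_eq ?_
      have hcard : ((I n).card : ℝ≥0∞) = ENNReal.ofReal (2 * N * 2 ^ n) := by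
        rw [← ENNReal.ofReal_natCast]
        congr 1
        have : (I n).card = 2 * N * 2 ^ n := by
          have h2 : ((2 * N * 2 ^ n : ℕ) : ℤ) = N * 2 ^ n - -(N * 2 ^ n) := by push_cast; ring
          rw [Int.card_Ico, ← h2, Int.toNat_natCast]
        rw [this]
        push_cast
        ring
      rw [nsmul_eq_mul, hcard, ← mul_assoc, ← mul_assoc, ← ENNReal.ofReal_mul (by positivity),
        ← ENNReal.ofReal_pow (by positivity), ← ENNReal.ofReal_mul (by positivity)]
      congr 2
      rw [mul_pow]
      ring
    refine ne_top_of_le_ne_top ?_ (ENNReal.tsum_le_tsum hle)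
    rw [ENNReal.tsum_mul_right, ENNReal.tsum_geometric]
    refine ENNReal.mul_ne_top (ENNReal.inv_ne_top.2 ?_)
      (ENNReal.mul_ne_top ENNReal.ofReal_ne_top (gaussianMomentConst_ne_top m hc.le))
    exact (tsub_pos_of_lt (by rw [ENNReal.ofReal_lt_one]; linarith)).ne'
  refine ⟨fun ω ↦ Real.exp c + (S ω).toReal,
    (integrable_const _).add (integrable_toReal_of_lintegral_ne_top hSm hS), fun ω ↦ ?_, ?_⟩
  · have := Real.one_le_exp hc.le
    have := ENNReal.toReal_nonneg (a := S ω)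
    linarith
  filter_upwards [ae_lt_top' hSm hS] with ω hω n k hk1 hk2
  -- A weighted increment is at most `1`, or its exponential is at most its own term of the series.
  have hxG : Real.exp (c * x n k ω) ≤ Real.exp c + (S ω).toReal := by
    rcases le_total (x n k ω) 1 with h1 | h1
    · have : Real.exp (c * x n k ω) ≤ Real.exp c := by
        gcongr
        exact mul_le_of_le_one_right hc.le h1
      have := ENNReal.toReal_nonneg (a := S ω)
      linarith
    · have h2 : Real.exp (c * x n k ω) ≤ (x n k ω) ^ m * Real.exp (c * x n k ω) :=
        le_mul_of_one_le_left (Real.exp_pos _).le (one_le_pow₀ h1)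
      have h3 : (x n k ω) ^ m * Real.exp (c * x n k ω) ≤ (S ω).toReal := by
        rw [← ENNReal.ofReal_le_iff_le_toReal hω.ne]
        refine le_trans ?_ (ENNReal.le_tsum n)
        exact Finset.single_le_sum
          (f := fun k ↦ ENNReal.ofReal ((x n k ω) ^ m * Real.exp (c * x n k ω)))
          (fun _ _ ↦ zero_le) (Finset.mem_Ico.2 ⟨hk1, hk2⟩)
      have := Real.exp_pos c
      linarith
  have hpos : 0 < Real.exp c + (S ω).toReal := (Real.exp_pos _).trans_le hxG
  have hlog := (Real.le_log_iff_exp_le hpos).2 hxG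
  have h4 : x n k ω ≤ Real.log (Real.exp c + (S ω).toReal) / c := by
    rw [le_div_iff₀ hc]
    linarith
  have h5 : |B ((k + 1) / 2 ^ n) ω - B (k / 2 ^ n) ω| = x n k ω * ρ ^ n := by
    simp only [x]
    rw [inv_pow]
    field_simp
  rw [h5]
  gcongr

/-- A separable fractional Brownian motion is continuous on a bounded interval, and the supremum
of its modulus there has exponential moments of all orders. -/
theorem exists_integrable_exp_bound (hα : 0 < α) (hB : IsFractionalBrownianMotion α B P)
    (hsep : IsSeparableProcess B P) (N : ℕ) {c : ℝ} (hc : 0 < c) :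
    ∃ G : Ω → ℝ, Integrable G P ∧ ∀ᵐ ω ∂P,
      ContinuousOn (fun t ↦ B t ω) (Set.Ioo (-N) N) ∧
      ∀ t ∈ Set.Ioo (-N : ℝ) N, Real.exp (c * |B t ω|) ≤ G ω := by
  obtain ⟨D, hDc, hD⟩ := hsep
  set ρ : ℝ := 2 ^ (-(α / 4)) with hρ
  have hρ0 : 0 < ρ := by rw [hρ]; positivity
  have hρ1 : ρ < 1 := by
    rw [hρ]; exact Real.rpow_lt_one_of_one_lt_of_neg (by norm_num) (by linarith)
  have hK : 0 < 1 / (1 - ρ) + N := by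
    have : 0 < 1 - ρ := by linarith
    positivity
  obtain ⟨G, hG, hG1, hGb⟩ := hB.exists_integrable_forall_dyadic hα N
    (c := c * (1 / (1 - ρ) + N)) (by positivity) hρ
  refine ⟨G, hG, ?_⟩
  have hconv : ∀ᵐ ω ∂P, ∀ t ∈ D, Tendsto (fun n ↦ B (dyadicFloor n t) ω) atTop (𝓝 (B t ω)) :=
    (ae_ball_iff hDc).2 fun t _ ↦ hB.ae_tendsto_dyadicFloor hα t
  filter_upwards [hD, hGb, hconv, hB.ae_eval_zero hα] with ω h1 h2 h3 h4
  obtain ⟨hcont, hbd⟩ := continuousOn_and_abs_le_of_separable h2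
    (div_nonneg (Real.log_nonneg (hG1 ω)) (by positivity)) hρ0.le hρ1 h4 h3 h1
  refine ⟨hcont, fun t ht ↦ ?_⟩
  rw [← Real.le_log_iff_exp_le (zero_lt_one.trans_le (hG1 ω))]
  calc c * |B t ω| ≤ c * ((1 / (1 - ρ) + N) *
        (Real.log (G ω) / (c * (1 / (1 - ρ) + N)))) := by gcongr; exact hbd t ht
    _ = Real.log (G ω) := by field_simp

/-- Almost every path of a separable fractional Brownian motion is continuous. -/
theorem ae_continuous (hα : 0 < α) (hB : IsFractionalBrownianMotion α B P)
    (hsep : IsSeparableProcess B P) : ∀ᵐ ω ∂P, Continuous fun t ↦ B t ω := by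
  have h : ∀ᵐ ω ∂P, ∀ N : ℕ, ContinuousOn (fun t ↦ B t ω) (Set.Ioo (-N) N) := by
    refine ae_all_iff.2 fun N ↦ ?_
    obtain ⟨G, -, hG⟩ := hB.exists_integrable_exp_bound hα hsep N one_pos
    filter_upwards [hG] with ω hω using hω.1
  filter_upwards [h] with ω hω
  refine continuous_iff_continuousAt.2 fun t ↦ ?_
  obtain ⟨N, hN⟩ := exists_nat_gt |t|
  exact (hω N).continuousAt (isOpen_Ioo.mem_nhds (abs_lt.1 hN))

/-- The exponential of every multiple of `|Z|` is bounded on a compact interval by an integrable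
random variable. -/
theorem exists_integrable_exp_driftedProcess_bound (hα : 0 < α)
    (hB : IsFractionalBrownianMotion α B P) (hsep : IsSeparableProcess B P) (T : ℝ) {c : ℝ}
    (hc : 0 < c) :
    ∃ G : Ω → ℝ, Integrable G P ∧ ∀ᵐ ω ∂P,
      ∀ t ∈ Set.Icc (-T) T, Real.exp (c * abs (driftedProcess α B t ω)) ≤ G ω := by
  obtain ⟨N, hN⟩ := exists_nat_gt T
  obtain ⟨G, hG, hGb⟩ := hB.exists_integrable_exp_bound hα hsep N (c := c * √2) (by positivity)
  refine ⟨fun ω ↦ G ω * Real.exp (c * T ^ α), hG.mul_const _, ?_⟩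
  filter_upwards [hGb] with ω hω t ht
  have hb := hω.2 t ⟨by linarith [ht.1], by linarith [ht.2]⟩
  have hT : |t| ^ α ≤ T ^ α := Real.rpow_le_rpow (abs_nonneg _) (abs_le.2 ht) hα.le
  calc Real.exp (c * abs (driftedProcess α B t ω))
      ≤ Real.exp (c * √2 * |B t ω|) * Real.exp (c * T ^ α) := by
        rw [← Real.exp_add]
        gcongr
        have := abs_sub (√2 * B t ω) (|t| ^ α)
        rw [abs_mul, abs_of_nonneg (Real.sqrt_nonneg 2),
          abs_of_nonneg (show (0 : ℝ) ≤ |t| ^ α by positivity)] at this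
        rw [driftedProcess, mul_assoc, ← mul_add]
        gcongr
        linarith
    _ ≤ _ := by gcongr

end IsFractionalBrownianMotion

end Paths

/-! ### Discretization of the supremum and of the integral -/

section Discretization

open Filter Topology

/-- The points of the partition of `[0, T]` into `n + 1` intervals of equal length. The indices
`i ≤ n` give the left endpoints, and `i = n + 1` gives `T`. -/
noncomputable def grid (T : ℝ) (n i : ℕ) : ℝ := i * (T / (n + 1))

theorem grid_mem_Icc {T : ℝ} (hT : 0 ≤ T) {n i : ℕ} (hi : i ≤ n + 1) :
    grid T n i ∈ Set.Icc 0 T := by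
  have hi' : (i : ℝ) ≤ n + 1 := by exact_mod_cast hi
  have hn : (0 : ℝ) < n + 1 := by positivity
  refine ⟨by unfold grid; positivity, ?_⟩
  calc grid T n i ≤ (n + 1) * (T / (n + 1)) := by unfold grid; gcongr
    _ = T := by field_simp

theorem tendsto_mesh (T : ℝ) : Tendsto (fun n : ℕ ↦ T / ((n : ℝ) + 1)) atTop (𝓝 0) := by
  simpa [div_eq_mul_inv] using
    (tendsto_one_div_add_atTop_nhds_zero_nat (𝕜 := ℝ)).const_mul T

theorem tendsto_riemannSum {T : ℝ} (hT : 0 < T) {g : ℝ → ℝ} (hg : ContinuousOn g (Set.Icc 0 T)) :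
    Tendsto (fun n : ℕ ↦ T / (n + 1) * ∑ i : Fin (n + 1), g (grid T n i)) atTop
      (𝓝 (∫ s in (0 : ℝ)..T, g s)) := by
  rw [Metric.tendsto_atTop]
  intro ε hε
  obtain ⟨δ, hδ, hgδ⟩ := Metric.uniformContinuousOn_iff_le.1
    (isCompact_Icc.uniformContinuousOn_of_continuous hg) (ε / (2 * T)) (by positivity)
  obtain ⟨n₀, hn₀⟩ := eventually_atTop.1 ((tendsto_mesh T).eventually_lt_const hδ)
  refine ⟨n₀, fun n hn ↦ ?_⟩
  have hmesh := hn₀ n hn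
  have hstep : ∀ i : ℕ, grid T n (i + 1) - grid T n i = T / (n + 1) := fun i ↦ by
    unfold grid; push_cast; ring
  have hle : ∀ i : ℕ, grid T n i ≤ grid T n (i + 1) := fun i ↦ by
    have := hstep i
    have : 0 ≤ T / ((n : ℝ) + 1) := by positivity
    linarith
  have hsub : ∀ i < n + 1, Set.Icc (grid T n i) (grid T n (i + 1)) ⊆ Set.Icc 0 T := fun i hi ↦
    Set.Icc_subset_Icc (grid_mem_Icc hT.le hi.le).1 (grid_mem_Icc hT.le hi).2
  have hint : ∀ i < n + 1, IntervalIntegrable g volume (grid T n i) (grid T n (i + 1)) :=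
    fun i hi ↦ (hg.mono (by rw [Set.uIcc_of_le (hle i)]; exact hsub i hi)).intervalIntegrable
  have hsplit : ∫ s in (0 : ℝ)..T, g s =
      ∑ i ∈ Finset.range (n + 1), ∫ s in (grid T n i)..(grid T n (i + 1)), g s := by
    rw [intervalIntegral.sum_integral_adjacent_intervals hint]
    congr 1
    · simp [grid]
    · unfold grid; push_cast; field_simp
  have hcell : ∀ i ∈ Finset.range (n + 1),
      |T / (n + 1) * g (grid T n i) - ∫ s in (grid T n i)..(grid T n (i + 1)), g s| ≤
        ε / (2 * T) * (T / (n + 1)) := by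
    intro i hi
    rw [Finset.mem_range] at hi
    have hconst : T / (n + 1) * g (grid T n i) =
        ∫ _ in (grid T n i)..(grid T n (i + 1)), g (grid T n i) := by
      rw [intervalIntegral.integral_const, hstep, smul_eq_mul]
    rw [hconst, ← intervalIntegral.integral_sub intervalIntegrable_const (hint i hi)]
    have := intervalIntegral.norm_integral_le_of_norm_le_const (a := grid T n i)
      (b := grid T n (i + 1)) (C := ε / (2 * T)) (f := fun s ↦ g (grid T n i) - g s)
      (fun s hs ↦ by
        rw [Set.uIoc_of_le (hle i)] at hs
        refine hgδ _ (hsub i hi ⟨le_rfl, hle i⟩) _ (hsub i hi ⟨hs.1.le, hs.2⟩) ?_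
        rw [dist_comm, Real.dist_eq, abs_of_nonneg (by linarith [hs.1])]
        linarith [hs.2, hstep i])
    rwa [hstep, abs_of_nonneg (by positivity : 0 ≤ T / ((n : ℝ) + 1))] at this
  rw [Real.dist_eq, hsplit, Fin.sum_univ_eq_sum_range (fun i ↦ g (grid T n i)), Finset.mul_sum,
    ← Finset.sum_sub_distrib]
  refine (Finset.abs_sum_le_sum_abs _ _).trans_lt ((Finset.sum_le_sum hcell).trans_lt ?_)
  rw [Finset.sum_const, Finset.card_range, nsmul_eq_mul]
  push_cast
  rw [show ((n : ℝ) + 1) * (ε / (2 * T) * (T / (n + 1))) = ε / 2 by field_simp]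
  linarith

theorem tendsto_iSup_grid {T : ℝ} (hT : 0 < T) {g : ℝ → ℝ} (hg : ContinuousOn g (Set.Icc 0 T)) :
    Tendsto (fun n : ℕ ↦ ⨆ i : Fin (n + 1), g (grid T n i)) atTop
      (𝓝 (sSup (g '' Set.Icc 0 T))) := by
  have hbdd : BddAbove (g '' Set.Icc 0 T) := isCompact_Icc.bddAbove_image hg
  have hne : (Set.Icc 0 T).Nonempty := ⟨0, le_rfl, hT.le⟩
  obtain ⟨x, hx, hxmax⟩ := isCompact_Icc.exists_sSup_image_eq hne hg
  have hupper : ∀ n : ℕ, ⨆ i : Fin (n + 1), g (grid T n i) ≤ sSup (g '' Set.Icc 0 T) := fun n ↦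
    ciSup_le fun i ↦ le_csSup hbdd ⟨_, grid_mem_Icc hT.le i.is_lt.le, rfl⟩
  rw [Metric.tendsto_atTop]
  intro ε hε
  obtain ⟨δ, hδ, hgδ⟩ := Metric.continuousOn_iff.1 hg x hx ε hε
  obtain ⟨n₀, hn₀⟩ := eventually_atTop.1 ((tendsto_mesh T).eventually_lt_const hδ)
  refine ⟨n₀, fun n hn ↦ ?_⟩
  have hmesh := hn₀ n hn
  have hpos : (0 : ℝ) < T / (n + 1) := by positivity
  -- a grid point within one mesh of the maximizer `x`; the right endpoint `T` is not a grid point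
  obtain ⟨i, hi⟩ : ∃ i : Fin (n + 1), |grid T n i - x| ≤ T / (n + 1) := by
    have hq0 : 0 ≤ x / (T / (n + 1)) := div_nonneg hx.1 hpos.le
    have hq1 := Nat.floor_le hq0
    have hq2 := Nat.lt_floor_add_one (x / (T / (n + 1)))
    rw [le_div_iff₀ hpos] at hq1
    rw [div_lt_iff₀ hpos] at hq2
    set q := ⌊x / (T / (n + 1))⌋₊
    rcases lt_or_ge q (n + 1) with h | h
    · refine ⟨⟨q, h⟩, ?_⟩
      rw [abs_le]
      unfold grid
      simp only
      constructor <;> linarith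
    · refine ⟨⟨n, by omega⟩, ?_⟩
      have hnT : ((n : ℝ) + 1) * (T / (n + 1)) = T := by field_simp
      have hqn : ((n : ℝ) + 1) ≤ q := by exact_mod_cast h
      have : T ≤ x := by
        rw [← hnT]
        exact (mul_le_mul_of_nonneg_right hqn hpos.le).trans hq1
      have hxT := hx.2
      rw [abs_le]
      unfold grid
      simp only
      constructor <;> linarith
  have hclose := hgδ _ (grid_mem_Icc hT.le i.is_lt.le) (hi.trans_lt hmesh)
  have hlow : g (grid T n i) ≤ ⨆ i : Fin (n + 1), g (grid T n i) :=
    le_ciSup (f := fun i : Fin (n + 1) ↦ g (grid T n i)) (Set.finite_range _).bddAbove i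
  have hup := hupper n
  rw [Real.dist_eq, abs_lt] at *
  constructor <;> linarith

/-- The ratio of the supremum and the integral of `exp z` over `[0, T]`. -/
noncomputable def pathRatio (T : ℝ) (z : ℝ → ℝ) : ℝ :=
  sSup ((fun s ↦ Real.exp (z s)) '' Set.Icc 0 T) / ∫ s in (0 : ℝ)..T, Real.exp (z s)

/-- The discretization of `pathRatio`, as a function of the values at the left endpoints of the
grid. -/
noncomputable def gridRatio (T : ℝ) (n : ℕ) (x : Fin (n + 1) → ℝ) : ℝ :=
  (⨆ i, Real.exp (x i)) / (T / (n + 1) * ∑ i, Real.exp (x i))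

theorem measurable_gridRatio (T : ℝ) (n : ℕ) : Measurable (gridRatio T n) := by
  unfold gridRatio
  refine Measurable.div (Measurable.iSup fun i ↦ by fun_prop) (by fun_prop)

theorem gridRatio_sub_const (T : ℝ) (n : ℕ) (x : Fin (n + 1) → ℝ) (c : ℝ) :
    gridRatio T n (fun i ↦ x i - c) = gridRatio T n x := by
  simp only [gridRatio, sub_eq_add_neg, Real.exp_add, ← Finset.sum_mul]
  rw [← Real.iSup_mul_of_nonneg (Real.exp_pos _).le, ← mul_assoc,
    mul_div_mul_right _ _ (Real.exp_pos _).ne']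

theorem gridRatio_nonneg {T : ℝ} (hT : 0 < T) (n : ℕ) (x : Fin (n + 1) → ℝ) :
    0 ≤ gridRatio T n x := by
  refine div_nonneg (Real.iSup_nonneg fun i ↦ (Real.exp_pos _).le) ?_
  positivity

theorem gridRatio_le {T : ℝ} (hT : 0 < T) (n : ℕ) {x : Fin (n + 1) → ℝ} {M : ℝ}
    (hM : ∀ i, |x i| ≤ M) : gridRatio T n x ≤ Real.exp (2 * M) / T := by
  have h1 : ⨆ i, Real.exp (x i) ≤ Real.exp M :=
    ciSup_le fun i ↦ Real.exp_le_exp.2 (abs_le.1 (hM i)).2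
  have h2 : T * Real.exp (-M) ≤ T / (n + 1) * ∑ i, Real.exp (x i) := by
    have : ∑ _i : Fin (n + 1), Real.exp (-M) ≤ ∑ i, Real.exp (x i) :=
      Finset.sum_le_sum fun i _ ↦ Real.exp_le_exp.2 (abs_le.1 (hM i)).1
    rw [Finset.sum_const, Finset.card_univ, Fintype.card_fin, nsmul_eq_mul] at this
    calc T * Real.exp (-M) = T / (n + 1) * (((n + 1 : ℕ) : ℝ) * Real.exp (-M)) := by
          push_cast; field_simp
      _ ≤ _ := by gcongr
  calc gridRatio T n x ≤ Real.exp M / (T * Real.exp (-M)) := by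
        unfold gridRatio
        gcongr
    _ = Real.exp (2 * M) / T := by
        rw [two_mul, Real.exp_add, Real.exp_neg]
        field_simp

theorem integral_exp_pos {T : ℝ} (hT : 0 < T) {z : ℝ → ℝ} (hz : Continuous z) :
    0 < ∫ s in (0 : ℝ)..T, Real.exp (z s) :=
  intervalIntegral.intervalIntegral_pos_of_pos
    ((Real.continuous_exp.comp hz).intervalIntegrable _ _) (fun _ ↦ Real.exp_pos _) hT

theorem tendsto_gridRatio {T : ℝ} (hT : 0 < T) {z : ℝ → ℝ} (hz : Continuous z) :
    Tendsto (fun n : ℕ ↦ gridRatio T n fun i ↦ z (grid T n i)) atTop (𝓝 (pathRatio T z)) := by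
  have he : ContinuousOn (fun s ↦ Real.exp (z s)) (Set.Icc 0 T) :=
    (Real.continuous_exp.comp hz).continuousOn
  exact (tendsto_iSup_grid hT he).div (tendsto_riemannSum hT he) (integral_exp_pos hT hz).ne'

theorem pathRatio_nonneg {T : ℝ} (hT : 0 < T) {z : ℝ → ℝ} (hz : Continuous z) :
    0 ≤ pathRatio T z :=
  ge_of_tendsto' (tendsto_gridRatio hT hz) fun n ↦ gridRatio_nonneg hT n _

theorem pathRatio_le {T : ℝ} (hT : 0 < T) {z : ℝ → ℝ} (hz : Continuous z) {M : ℝ}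
    (hM : ∀ s ∈ Set.Icc 0 T, |z s| ≤ M) : pathRatio T z ≤ Real.exp (2 * M) / T :=
  le_of_tendsto' (tendsto_gridRatio hT hz) fun n ↦
    gridRatio_le hT n fun i ↦ hM _ (grid_mem_Icc hT.le i.is_lt.le)

theorem integral_mul_pathRatio {T : ℝ} (hT : 0 < T) {z : ℝ → ℝ} (hz : Continuous z) :
    (∫ s in (0 : ℝ)..T, Real.exp (z s)) * pathRatio T z =
      sSup ((fun s ↦ Real.exp (z s)) '' Set.Icc 0 T) :=
  mul_div_cancel₀ _ (integral_exp_pos hT hz).ne'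

end Discretization

/-! ### The expected ratio as a function of the shift -/

section Formula

open Filter Topology

variable {Ω : Type*} [MeasurableSpace Ω] {P : Measure Ω} {α : ℝ} {B : ℝ → Ω → ℝ}

namespace IsFractionalBrownianMotion

theorem ae_continuous_driftedProcess (hα : 0 < α) (hB : IsFractionalBrownianMotion α B P)
    (hsep : IsSeparableProcess B P) : ∀ᵐ ω ∂P, Continuous fun t ↦ driftedProcess α B t ω := by
  filter_upwards [hB.ae_continuous hα hsep] with ω hω
  exact (hω.const_mul _).sub (continuous_abs.rpow_const fun _ ↦ Or.inr hα.le)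

/-- A random bound `M` for `|Z|` on `[-T, T]` such that `exp (3 M)` is integrable. The order `3`
accounts for one factor `exp (Z t)` and for the bound `exp (2 M) / T` on the ratio. -/
theorem exists_abs_driftedProcess_le (hα : 0 < α) (hB : IsFractionalBrownianMotion α B P)
    (hsep : IsSeparableProcess B P) {T : ℝ} (hT : 0 < T) :
    ∃ M : Ω → ℝ, Integrable (fun ω ↦ Real.exp (3 * M ω)) P ∧
      ∀ᵐ ω ∂P, 0 ≤ M ω ∧ ∀ t ∈ Set.Icc (-T) T, abs (driftedProcess α B t ω) ≤ M ω := by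
  obtain ⟨G, hG, hGb⟩ := hB.exists_integrable_exp_driftedProcess_bound hα hsep T
    (c := 3) (by norm_num)
  have h0 : (0 : ℝ) ∈ Set.Icc (-T) T := ⟨by linarith, hT.le⟩
  refine ⟨fun ω ↦ Real.log (G ω) / 3, hG.congr ?_, ?_⟩
  · filter_upwards [hGb] with ω hω
    rw [mul_div_cancel₀ _ (by norm_num : (3 : ℝ) ≠ 0),
      Real.exp_log ((Real.exp_pos _).trans_le (hω 0 h0))]
  · filter_upwards [hGb] with ω hω
    have hb : ∀ t ∈ Set.Icc (-T) T, abs (driftedProcess α B t ω) ≤ Real.log (G ω) / 3 :=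
        fun t ht ↦ by
      rw [le_div_iff₀ (by norm_num), mul_comm,
        Real.le_log_iff_exp_le ((Real.exp_pos _).trans_le (hω 0 h0))]
      exact hω t ht
    exact ⟨(abs_nonneg _).trans (hb 0 h0), hb⟩

theorem aestronglyMeasurable_gridRatio (hB : IsFractionalBrownianMotion α B P) (T t : ℝ) (n : ℕ) :
    AEStronglyMeasurable
      (fun ω ↦ gridRatio T n fun i ↦ driftedProcess α B (grid T n i - t) ω) P :=
  ((measurable_gridRatio T n).comp_aemeasurable (aemeasurable_pi_lambda _ fun i ↦
    hB.aemeasurable_driftedProcess (grid T n i - t))).aestronglyMeasurable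

theorem aestronglyMeasurable_pathRatio (hα : 0 < α) (hB : IsFractionalBrownianMotion α B P)
    (hsep : IsSeparableProcess B P) {T : ℝ} (hT : 0 < T) (t : ℝ) :
    AEStronglyMeasurable (fun ω ↦ pathRatio T fun s ↦ driftedProcess α B (s - t) ω) P := by
  refine aestronglyMeasurable_of_tendsto_ae atTop
    (fun n ↦ hB.aestronglyMeasurable_gridRatio T t n) ?_
  filter_upwards [hB.ae_continuous_driftedProcess hα hsep] with ω hω
  exact tendsto_gridRatio hT (z := fun s ↦ driftedProcess α B (s - t) ω) (by fun_prop)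

theorem integrable_pathRatio (hα : 0 < α) (hB : IsFractionalBrownianMotion α B P)
    (hsep : IsSeparableProcess B P) {T : ℝ} (hT : 0 < T) {t : ℝ} (ht : t ∈ Set.Icc 0 T) :
    Integrable (fun ω ↦ pathRatio T fun s ↦ driftedProcess α B (s - t) ω) P := by
  obtain ⟨M, hM, hMb⟩ := hB.exists_abs_driftedProcess_le hα hsep hT
  refine (hM.div_const T).mono' (hB.aestronglyMeasurable_pathRatio hα hsep hT t) ?_
  filter_upwards [hMb, hB.ae_continuous_driftedProcess hα hsep] with ω hω hc
  have hz : Continuous fun s ↦ driftedProcess α B (s - t) ω := by fun_prop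
  rw [Real.norm_of_nonneg (pathRatio_nonneg hT hz)]
  refine (pathRatio_le hT hz fun s hs ↦
    hω.2 _ ⟨by linarith [hs.1, ht.2], by linarith [hs.2, ht.1]⟩).trans ?_
  gcongr
  exacts [hω.1, by norm_num]

/-- The change of measure formula for the ratio of the supremum and the integral. -/
theorem integral_exp_mul_pathRatio (hα : 0 < α) (hB : IsFractionalBrownianMotion α B P)
    (hsep : IsSeparableProcess B P) {T : ℝ} (hT : 0 < T) {t : ℝ} (ht : t ∈ Set.Icc 0 T) :
    ∫ ω, Real.exp (driftedProcess α B t ω) * pathRatio T (fun s ↦ driftedProcess α B s ω) ∂P =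
      ∫ ω, pathRatio T (fun s ↦ driftedProcess α B (s - t) ω) ∂P := by
  obtain ⟨M, hM, hMb⟩ := hB.exists_abs_driftedProcess_le hα hsep hT
  have hcont := hB.ae_continuous_driftedProcess hα hsep
  have hmesh : ∀ {n : ℕ} (i : Fin (n + 1)), grid T n i ∈ Set.Icc 0 T := fun i ↦
    grid_mem_Icc hT.le i.is_lt.le
  have hbound : Integrable (fun ω ↦ Real.exp (3 * M ω) / T) P := hM.div_const T
  have hl : Tendsto (fun n ↦ ∫ ω, Real.exp (driftedProcess α B t ω) *
      gridRatio T n (fun i ↦ driftedProcess α B (grid T n i) ω) ∂P) atTop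
      (𝓝 (∫ ω, Real.exp (driftedProcess α B t ω) *
        pathRatio T (fun s ↦ driftedProcess α B s ω) ∂P)) := by
    refine tendsto_integral_of_dominated_convergence _ (fun n ↦ ?_) hbound (fun n ↦ ?_) ?_
    · refine (Real.measurable_exp.comp_aemeasurable
        (hB.aemeasurable_driftedProcess t)).aestronglyMeasurable.mul ?_
      simpa using hB.aestronglyMeasurable_gridRatio T 0 n
    · filter_upwards [hMb] with ω hω
      rw [Real.norm_of_nonneg (mul_nonneg (Real.exp_pos _).le (gridRatio_nonneg hT n _))]
      have h1 : Real.exp (driftedProcess α B t ω) ≤ Real.exp (M ω) :=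
        Real.exp_le_exp.2 (abs_le.1 (hω.2 t ⟨by linarith [ht.1], ht.2⟩)).2
      have h2 := gridRatio_le hT n (x := fun i ↦ driftedProcess α B (grid T n i) ω)
        (M := M ω) fun i ↦ hω.2 _ ⟨by linarith [(hmesh i).1], (hmesh i).2⟩
      calc _ ≤ Real.exp (M ω) * (Real.exp (2 * M ω) / T) :=
            mul_le_mul h1 h2 (gridRatio_nonneg hT n _) (Real.exp_pos _).le
        _ = Real.exp (3 * M ω) / T := by
            rw [← mul_div_assoc, ← Real.exp_add]; ring_nf
    · filter_upwards [hcont] with ω hω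
      exact (tendsto_gridRatio hT hω).const_mul _
  have hr : Tendsto (fun n ↦ ∫ ω,
      gridRatio T n (fun i ↦ driftedProcess α B (grid T n i - t) ω) ∂P) atTop
      (𝓝 (∫ ω, pathRatio T (fun s ↦ driftedProcess α B (s - t) ω) ∂P)) := by
    refine tendsto_integral_of_dominated_convergence _
      (fun n ↦ hB.aestronglyMeasurable_gridRatio T t n) hbound (fun n ↦ ?_) ?_
    · filter_upwards [hMb] with ω hω
      rw [Real.norm_of_nonneg (gridRatio_nonneg hT n _)]
      refine (gridRatio_le hT n (M := M ω) fun i ↦ hω.2 _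
        ⟨by linarith [(hmesh i).1, ht.2], by linarith [(hmesh i).2, ht.1]⟩).trans ?_
      gcongr
      exacts [hω.1, by norm_num]
    · filter_upwards [hcont] with ω hω
      exact tendsto_gridRatio hT (z := fun s ↦ driftedProcess α B (s - t) ω) (by fun_prop)
  refine tendsto_nhds_unique hl (hr.congr fun n ↦ ?_)
  exact (hB.integral_exp_mul_comp hα t (fun i : Fin (n + 1) ↦ grid T n i)
    (measurable_gridRatio T n) (gridRatio_sub_const T n)).symm

theorem aestronglyMeasurable_exp_mul_pathRatio (hα : 0 < α)
    (hB : IsFractionalBrownianMotion α B P) (hsep : IsSeparableProcess B P) {T : ℝ} (hT : 0 < T)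
    (t : ℝ) :
    AEStronglyMeasurable (fun ω ↦ Real.exp (driftedProcess α B t ω) *
      pathRatio T (fun s ↦ driftedProcess α B s ω)) P := by
  refine (Real.measurable_exp.comp_aemeasurable
    (hB.aemeasurable_driftedProcess t)).aestronglyMeasurable.mul ?_
  simpa using hB.aestronglyMeasurable_pathRatio hα hsep hT 0

theorem exists_bound_exp_mul_pathRatio (hα : 0 < α)
    (hB : IsFractionalBrownianMotion α B P) (hsep : IsSeparableProcess B P) {T : ℝ} (hT : 0 < T) :
    ∃ G : Ω → ℝ, Integrable G P ∧ ∀ᵐ ω ∂P, ∀ t ∈ Set.Icc 0 T,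
      |Real.exp (driftedProcess α B t ω) * pathRatio T (fun s ↦ driftedProcess α B s ω)| ≤
        G ω := by
  obtain ⟨M, hM, hMb⟩ := hB.exists_abs_driftedProcess_le hα hsep hT
  refine ⟨_, hM.div_const T, ?_⟩
  filter_upwards [hMb, hB.ae_continuous_driftedProcess hα hsep] with ω hω hc t ht
  have h1 : Real.exp (driftedProcess α B t ω) ≤ Real.exp (M ω) :=
    Real.exp_le_exp.2 (abs_le.1 (hω.2 t ⟨by linarith [ht.1], ht.2⟩)).2
  have h2 := pathRatio_le hT hc fun s hs ↦ hω.2 s ⟨by linarith [hs.1], hs.2⟩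
  rw [abs_of_nonneg (mul_nonneg (Real.exp_pos _).le (pathRatio_nonneg hT hc))]
  calc _ ≤ Real.exp (M ω) * (Real.exp (2 * M ω) / T) :=
        mul_le_mul h1 h2 (pathRatio_nonneg hT hc) (Real.exp_pos _).le
    _ = Real.exp (3 * M ω) / T := by
        rw [← mul_div_assoc, ← Real.exp_add]; ring_nf

/-- By the change of measure formula `t` enters the expected ratio only through the continuous
factor `exp (Z t)`. -/
theorem continuousOn_integral_pathRatio (hα : 0 < α) (hB : IsFractionalBrownianMotion α B P)
    (hsep : IsSeparableProcess B P) {T : ℝ} (hT : 0 < T) :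
    ContinuousOn (fun t ↦ ∫ ω, pathRatio T (fun s ↦ driftedProcess α B (s - t) ω) ∂P)
      (Set.Icc 0 T) := by
  obtain ⟨G, hG, hGb⟩ := hB.exists_bound_exp_mul_pathRatio hα hsep hT
  refine ContinuousOn.congr ?_ fun t ht ↦ (hB.integral_exp_mul_pathRatio hα hsep hT ht).symm
  refine continuousOn_of_dominated
    (fun t _ ↦ hB.aestronglyMeasurable_exp_mul_pathRatio hα hsep hT t) (fun t ht ↦ ?_) hG ?_
  · filter_upwards [hGb] with ω hω using hω t ht
  · filter_upwards [hB.ae_continuous_driftedProcess hα hsep] with ω hω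
    exact ((Real.continuous_exp.comp hω).mul continuous_const).continuousOn

/-- The expected supremum is the integral of the expected ratios. Both sides are limits of the same
Riemann sums in the shift parameter, which takes the place of an interchange of integrals. -/
theorem integral_integral_pathRatio (hα : 0 < α) (hB : IsFractionalBrownianMotion α B P)
    (hsep : IsSeparableProcess B P) {T : ℝ} (hT : 0 < T) :
    ∫ t in (0 : ℝ)..T, ∫ ω, pathRatio T (fun s ↦ driftedProcess α B (s - t) ω) ∂P =
      ∫ ω, expSup (driftedProcess α B) 0 T ω ∂P := by
  obtain ⟨G, hG, hGb⟩ := hB.exists_bound_exp_mul_pathRatio hα hsep hT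
  have hl := tendsto_riemannSum hT (hB.continuousOn_integral_pathRatio hα hsep hT)
  have hmeas := hB.aestronglyMeasurable_exp_mul_pathRatio hα hsep hT
  have hint : ∀ t ∈ Set.Icc 0 T, Integrable (fun ω ↦ Real.exp (driftedProcess α B t ω) *
      pathRatio T (fun s ↦ driftedProcess α B s ω)) P := fun t ht ↦
    hG.mono' (hmeas t) (by filter_upwards [hGb] with ω hω using hω t ht)
  have hr : Tendsto (fun n : ℕ ↦ ∫ ω, T / (n + 1) * ∑ i : Fin (n + 1),
      Real.exp (driftedProcess α B (grid T n i) ω) *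
        pathRatio T (fun s ↦ driftedProcess α B s ω) ∂P) atTop
      (𝓝 (∫ ω, expSup (driftedProcess α B) 0 T ω ∂P)) := by
    refine tendsto_integral_of_dominated_convergence (fun ω ↦ T * G ω)
      (fun n ↦ ?_) (hG.const_mul T) (fun n ↦ ?_) ?_
    · exact ((integrable_finsetSum _ fun i _ ↦ hint _
        (grid_mem_Icc hT.le i.is_lt.le)).const_mul _).aestronglyMeasurable
    · filter_upwards [hGb] with ω hω
      have h : |∑ i : Fin (n + 1), Real.exp (driftedProcess α B (grid T n i) ω) *
          pathRatio T (fun s ↦ driftedProcess α B s ω)| ≤ ((n + 1 : ℕ) : ℝ) * G ω := by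
        refine (Finset.abs_sum_le_sum_abs _ _).trans ?_
        refine (Finset.sum_le_card_nsmul _ _ (G ω) fun i _ ↦
          hω _ (grid_mem_Icc hT.le i.is_lt.le)).trans_eq ?_
        simp
      have hn : 0 ≤ T / ((n : ℝ) + 1) := by positivity
      rw [Real.norm_eq_abs, abs_mul, abs_of_nonneg hn]
      refine (mul_le_mul_of_nonneg_left h hn).trans_eq ?_
      push_cast
      field_simp
    · filter_upwards [hB.ae_continuous_driftedProcess hα hsep] with ω hω
      have h := (tendsto_riemannSum hT (g := fun s ↦ Real.exp (driftedProcess α B s ω))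
        (Real.continuous_exp.comp hω).continuousOn).mul_const
          (pathRatio T fun s ↦ driftedProcess α B s ω)
      rw [integral_mul_pathRatio hT hω] at h
      refine h.congr fun n ↦ ?_
      rw [mul_assoc, Finset.sum_mul]
  refine tendsto_nhds_unique hl (hr.congr fun n ↦ ?_)
  rw [integral_const_mul, integral_finsetSum _ fun i _ ↦ hint _ (grid_mem_Icc hT.le i.is_lt.le)]
  congr 1
  exact Finset.sum_congr rfl fun i _ ↦
    hB.integral_exp_mul_pathRatio hα hsep hT (grid_mem_Icc hT.le i.is_lt.le)

theorem integrable_expSup (hα : 0 < α) (hB : IsFractionalBrownianMotion α B P)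
    (hsep : IsSeparableProcess B P) {T : ℝ} (hT : 0 < T) :
    Integrable (fun ω ↦ expSup (driftedProcess α B) 0 T ω) P := by
  obtain ⟨M, hM, hMb⟩ := hB.exists_abs_driftedProcess_le hα hsep hT
  have hcont := hB.ae_continuous_driftedProcess hα hsep
  refine hM.mono' (aestronglyMeasurable_of_tendsto_ae atTop
    (f := fun (n : ℕ) ω ↦ ⨆ i : Fin (n + 1), Real.exp (driftedProcess α B (grid T n i) ω))
    (fun n ↦ (AEMeasurable.iSup fun i ↦ Real.measurable_exp.comp_aemeasurable
      (hB.aemeasurable_driftedProcess _)).aestronglyMeasurable) ?_) ?_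
  · filter_upwards [hcont] with ω hω
    exact tendsto_iSup_grid hT (Real.continuous_exp.comp hω).continuousOn
  · filter_upwards [hMb] with ω hω
    have h0 : 0 ≤ expSup (driftedProcess α B) 0 T ω :=
      Real.sSup_nonneg (by rintro _ ⟨s, -, rfl⟩; exact (Real.exp_pos _).le)
    rw [Real.norm_of_nonneg h0]
    refine csSup_le ⟨_, 0, ⟨le_rfl, hT.le⟩, rfl⟩ ?_
    rintro _ ⟨s, hs, rfl⟩
    refine Real.exp_le_exp.2 ?_
    linarith [(abs_le.1 (hω.2 s ⟨by linarith [hs.1], hs.2⟩)).2, hω.1]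

end IsFractionalBrownianMotion

omit [MeasurableSpace Ω] in
/-- The substitution `s ↦ s - u T` moves the interval `[-u T, (1 - u) T]` to `[0, T]`. -/
theorem expSup_div_expIntegral {Z : ℝ → Ω → ℝ} {T : ℝ} (hT : 0 ≤ T) (u : ℝ) (ω : Ω) :
    expSup Z (-u * T) ((1 - u) * T) ω / expIntegral Z (-u * T) ((1 - u) * T) ω =
      pathRatio T fun s ↦ Z (s - u * T) ω := by
  have hab : -u * T ≤ (1 - u) * T := by linarith
  have e1 : 0 - u * T = -u * T := by ring
  have e2 : T - u * T = (1 - u) * T := by ring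
  rw [pathRatio, expSup, expIntegral, integral_Icc_eq_integral_Ioc,
    ← intervalIntegral.integral_of_le hab,
    intervalIntegral.integral_comp_sub_right (fun s ↦ Real.exp (Z s ω)), e1, e2]
  congr 2
  rw [← e1, ← e2, ← Set.image_sub_const_Icc, Set.image_image]

end Formula

theorem mainTheorem6 {Ω : Type*} [MeasurableSpace Ω] (P : Measure Ω) [IsProbabilityMeasure P]
    (α : ℝ) (hα_pos : 0 < α) (hα_le : α ≤ 2) (B : ℝ → Ω → ℝ)
    (hB : IsFractionalBrownianMotion α B P) (hsep : IsSeparableProcess B P)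
    (T : ℝ) (hT : 0 < T) :
    (∀ᵐ ω ∂P, ∀ a b : ℝ,
      BddAbove ((fun t ↦ Real.exp (driftedProcess α B t ω)) '' Set.Icc a b) ∧
      IntegrableOn (fun t ↦ Real.exp (driftedProcess α B t ω)) (Set.Icc a b)) ∧
    Integrable (fun ω ↦ expSup (driftedProcess α B) 0 T ω) P ∧
    (∀ u ∈ Set.Icc (0 : ℝ) 1,
      Integrable (fun ω ↦ expSup (driftedProcess α B) (-u * T) ((1 - u) * T) ω /
        expIntegral (driftedProcess α B) (-u * T) ((1 - u) * T) ω) P) ∧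
    IntervalIntegrable (fun u ↦ ∫ ω, expSup (driftedProcess α B) (-u * T) ((1 - u) * T) ω /
        expIntegral (driftedProcess α B) (-u * T) ((1 - u) * T) ω ∂P) volume 0 1 ∧
    1 / T * ∫ ω, expSup (driftedProcess α B) 0 T ω ∂P =
      ∫ u in (0 : ℝ)..1, ∫ ω, expSup (driftedProcess α B) (-u * T) ((1 - u) * T) ω /
        expIntegral (driftedProcess α B) (-u * T) ((1 - u) * T) ω ∂P := by
  have hcont := hB.ae_continuous_driftedProcess hα_pos hsep
  have hmem : ∀ u ∈ Set.Icc (0 : ℝ) 1, u * T ∈ Set.Icc 0 T := fun u hu ↦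
    ⟨mul_nonneg hu.1 hT.le, mul_le_of_le_one_left hT.le hu.2⟩
  simp only [expSup_div_expIntegral hT.le]
  refine ⟨?_, hB.integrable_expSup hα_pos hsep hT,
    fun u hu ↦ hB.integrable_pathRatio hα_pos hsep hT (hmem u hu), ?_, ?_⟩
  · filter_upwards [hcont] with ω hω a b
    have he : Continuous fun t ↦ Real.exp (driftedProcess α B t ω) := Real.continuous_exp.comp hω
    exact ⟨isCompact_Icc.bddAbove_image he.continuousOn, he.integrableOn_Icc⟩
  · refine ContinuousOn.intervalIntegrable ?_
    rw [Set.uIcc_of_le zero_le_one]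
    exact (hB.continuousOn_integral_pathRatio hα_pos hsep hT).comp
      (continuous_id.mul continuous_const).continuousOn hmem
  · rw [intervalIntegral.integral_comp_mul_right
      (fun t ↦ ∫ ω, pathRatio T (fun s ↦ driftedProcess α B (s - t) ω) ∂P) hT.ne', zero_mul,
      one_mul, hB.integral_integral_pathRatio hα_pos hsep hT, smul_eq_mul, one_div]
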